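/- **Theorem.** Let $E$ be a finite set of edges, each parametrized by $t\in(0,1)$. Let $G(2|E|,4|E|)$ be the complex-analytic Grassmann manifold of all $2|E|$-dimensional subspaces $P\subset\mathbb C^{4|E|}$, let $L_2(\Gamma)=\bigoplus_{e\in E}L_2(0,1)$, let $L_\infty(\Gamma)=\bigoplus_{e\in E}L_\infty(0,1)$ be the Banach space of complex potentials $V=(V_e)_{e\in E}$, and let $\widetilde{H^2}(\Gamma)=\bigoplus_{e\in E}H^2(0,1)$. For $\xi=(\xi_e)_{e\in E}\in(\mathbb C\setminus\{0\})^{|E|}$ (the edge lengths; formally $x=\xi_e t$ is the coordinate on the edge $e$), let $H(P)\subset\widetilde{H^2}(\Gamma)$ be the subspace of those $u=(u_e)_{e\in E}$ whose vector of vertex values $$\bigl(u_e(0),\ \xi_e^{-1}u_e'(0),\ u_e(1),\ -\xi_e^{-1}u_e'(1)\bigr)_{e\in E}\in\mathbb C^{4|E|}$$ belongs to $P$, with the norm of $\widetilde{H^2}(\Gamma)$, and let $L(P,V,\xi):H(P)\to L_2(\Gamma)$ be the bounded operator $$(L(P,V,\xi)u)_e=-\xi_e^{-2}u_e''+V_eu_e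 ,$$ that is, $-\frac{d^2}{dx^2}+V$. Let the extended dispersion relation be $$D_L=\{(P,V,\xi,\lambda)\ :\ L(P,V,\xi)-\lambda I:H(P)\to L_2(\Gamma)\ \text{does not have a bounded inverse}\}.$$ Then $D_L$ is a principal analytic subset of the complex Banach manifold $$M=G(2|E|,4|E|)\times L_\infty(\Gamma)\times(\mathbb C\setminus\{0\})^{|E|}\times\mathbb C,$$ i.e. every point of $M$ has an open neighbourhood $U$ with a scalar analytic function $f:U\to\mathbb C$ such that $D_L\cap U=\{p\in U: f(p)=0\}$. -/

import Mathlib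

open MeasureTheory Set Module
open scoped ENNReal Manifold ContDiff Topology

noncomputable section

namespace QuantumGraph

/-! ## Analytic subsets of complex manifolds -/

/-- A subset `D` of a complex-analytic (possibly infinite-dimensional) manifold `M` is a principal
analytic subset if every point of `M` has an open neighbourhood `U` on which `D` is the zero set
of one scalar analytic function (`ω` is the analytic smoothness class). -/
def IsPrincipalAnalyticSubset {X H M : Type*} [NormedAddCommGroup X] [NormedSpace ℂ X]
    [TopologicalSpace H] (I : ModelWithCorners ℂ X H) [TopologicalSpace M] [ChartedSpace H M]
    (D : Set M) : Prop :=
  ∀ p : M, ∃ U : Set M, IsOpen U ∧ p ∈ U ∧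
    ∃ f : M → ℂ, ContMDiffOn I 𝓘(ℂ, ℂ) ω f U ∧ ∀ x ∈ U, x ∈ D ↔ f x = 0

/-! ## The Grassmannian of vertex conditions

`E` is the set of edges.  On every edge there are four boundary values (the values and the
derivatives of a function at the two ends), so that the space of all vertex values is
`ℂ^(4|E|)`. -/

/-- The space `ℂ^(4|E|)` of values and derivatives at the ends of the edges. -/
abbrev VertexValues (E : Type*) : Type _ := E → Fin 4 → ℂ

/-- The space `ℂ^(2|E|)`. -/
abbrev HalfSpace (E : Type*) : Type _ := E → Fin 2 → ℂ

/-- The model space of the Grassmannian: linear maps from `ℂ^(2|E|)` to `ℂ^(2|E|)`. -/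
abbrev GrModel (E : Type*) [Fintype E] : Type _ := HalfSpace E →L[ℂ] HalfSpace E

/-- The Grassmannian `G(2|E|, 4|E|)` of all `2|E|`-dimensional subspaces of `ℂ^(4|E|)`. -/
def Gr (E : Type*) [Fintype E] : Type _ :=
  {P : Submodule ℂ (VertexValues E) // finrank ℂ P = 2 * Fintype.card E}

section Grassmannian

variable {E : Type*} [Fintype E]

/-- A linear identification of `ℂ^(4|E|)` with `ℂ^(2|E|) ⊕ ℂ^(2|E|)`, in other words a
decomposition `ℂ^(4|E|) = P₀ ⊕ R` with bases of the half-dimensional spaces `P₀` and `R`. -/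
abbrev Splitting (E : Type*) : Type _ := (HalfSpace E × HalfSpace E) ≃ₗ[ℂ] VertexValues E

/-- The linear map `x ↦ x + A x` from `P₀` to `ℂ^(4|E|) = P₀ ⊕ R` whose range is
the graph of `A : P₀ → R`. -/
def graphMap (φ : Splitting E) (A : GrModel E) : HalfSpace E →ₗ[ℂ] VertexValues E :=
  φ.toLinearMap ∘ₗ LinearMap.prod LinearMap.id A.toLinearMap

@[simp] lemma graphMap_apply (φ : Splitting E) (A : GrModel E) (x : HalfSpace E) :
    graphMap φ A x = φ (x, A x) := rfl

lemma graphMap_injective (φ : Splitting E) (A : GrModel E) :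
    Function.Injective (graphMap φ A) := by
  intro x y h
  have h' := φ.injective h
  exact congrArg Prod.fst h'

lemma finrank_halfSpace : finrank ℂ (HalfSpace E) = 2 * Fintype.card E := by
  rw [finrank_pi_fintype]
  simp [mul_comm]

/-- The graph of `A : P₀ → R`, as a point of the Grassmannian. -/
def graphPoint (φ : Splitting E) (A : GrModel E) : Gr E :=
  ⟨LinearMap.range (graphMap φ A), by
    rw [LinearMap.finrank_range_of_inj (graphMap_injective φ A), finrank_halfSpace]⟩

lemma graphPoint_injective (φ : Splitting E) : Function.Injective (graphPoint φ) := by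
  intro A B h
  ext1 x
  have hx : graphMap φ A x ∈ LinearMap.range (graphMap φ B) := by
    have h' : LinearMap.range (graphMap φ A) = LinearMap.range (graphMap φ B) :=
      congrArg Subtype.val h
    rw [← h']
    exact ⟨x, rfl⟩
  obtain ⟨y, hy⟩ := hx
  have h2 := φ.injective hy
  have h3 : y = x := congrArg Prod.fst h2
  have h4 : B y = A x := congrArg Prod.snd h2
  rw [← h4, h3]

/-- The chart of the Grassmannian given by a splitting `ℂ^(4|E|) = P₀ ⊕ R`: it is defined on the
set of the subspaces that are graphs of linear maps `A : P₀ → R`, and it sends the graph of `A`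
to `A`. -/
def graphChart (φ : Splitting E) : PartialEquiv (Gr E) (GrModel E) :=
  ((graphPoint_injective φ).injOn.toPartialEquiv (graphPoint φ) univ).symm

lemma graphChart_source (φ : Splitting E) : (graphChart φ).source = range (graphPoint φ) := by
  simp [graphChart]

lemma graphChart_symm_apply (φ : Splitting E) (A : GrModel E) :
    (graphChart φ).symm A = graphPoint φ A := rfl

lemma graphChart_graphPoint (φ : Splitting E) (A : GrModel E) :
    graphChart φ (graphPoint φ A) = A :=
  (graphChart φ).right_inv (x := A) (by simp [graphChart])

lemma exists_splitting (P : Gr E) : ∃ φ : Splitting E, P ∈ (graphChart φ).source := by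
  obtain ⟨R, hR⟩ := Submodule.exists_isCompl P.1
  have hW : finrank ℂ (VertexValues E) = 4 * Fintype.card E := by
    rw [finrank_pi_fintype]; simp [mul_comm]
  have hP := P.2
  have hsum := Submodule.finrank_add_eq_of_isCompl hR
  have hRd : finrank ℂ R = 2 * Fintype.card E := by omega
  let a : HalfSpace E ≃ₗ[ℂ] P.1 :=
    LinearEquiv.ofFinrankEq _ _ (by rw [finrank_halfSpace]; exact hP.symm)
  let b : HalfSpace E ≃ₗ[ℂ] R := LinearEquiv.ofFinrankEq _ _ (by rw [finrank_halfSpace, hRd])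
  let φ : Splitting E := (a.prodCongr b).trans (Submodule.prodEquivOfIsCompl P.1 R hR)
  refine ⟨φ, ?_⟩
  rw [graphChart_source]
  refine ⟨0, Subtype.ext ?_⟩
  ext w
  constructor
  · rintro ⟨x, rfl⟩
    simp [φ]
  · intro hw
    refine ⟨a.symm ⟨w, hw⟩, ?_⟩
    simp [φ]

/-- The coordinate change between two charts is `A ↦ B`, where the first and the second component
of `φ'⁻¹ (x, A x)` are `M_A x` and `B (M_A x)`. -/
def transFst (φ φ' : Splitting E) (A : GrModel E) : GrModel E :=
  LinearMap.toContinuousLinearMap (LinearMap.fst ℂ _ _ ∘ₗ φ'.symm.toLinearMap ∘ₗ graphMap φ A)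

/-- See `transFst`. -/
def transSnd (φ φ' : Splitting E) (A : GrModel E) : GrModel E :=
  LinearMap.toContinuousLinearMap (LinearMap.snd ℂ _ _ ∘ₗ φ'.symm.toLinearMap ∘ₗ graphMap φ A)

lemma transFst_apply (φ φ' : Splitting E) (A : GrModel E) (x : HalfSpace E) :
    transFst φ φ' A x = (φ'.symm (φ (x, A x))).1 := rfl

lemma transSnd_apply (φ φ' : Splitting E) (A : GrModel E) (x : HalfSpace E) :
    transSnd φ φ' A x = (φ'.symm (φ (x, A x))).2 := rfl

/-- A map of the form `A ↦ a + b ∘ A` is analytic. -/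
lemma contDiff_affine (ψ : (HalfSpace E × HalfSpace E) →ₗ[ℂ] HalfSpace E)
    (T : GrModel E → GrModel E) (hT : ∀ A x, T A x = ψ (x, A x)) : ContDiff ℂ ω T := by
  have : T = fun A => (LinearMap.toContinuousLinearMap ψ).comp
      ((ContinuousLinearMap.inl ℂ (HalfSpace E) (HalfSpace E)) +
        (ContinuousLinearMap.inr ℂ (HalfSpace E) (HalfSpace E)).comp A) := by
    funext A
    ext1 x
    have h : (x, A x) = (x, 0) + (0, A x) := by simp
    rw [hT, h, map_add]
    simp
  rw [this]
  fun_prop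

lemma contDiff_transFst (φ φ' : Splitting E) : ContDiff ℂ ω (transFst φ φ') :=
  contDiff_affine (LinearMap.fst ℂ _ _ ∘ₗ φ'.symm.toLinearMap ∘ₗ φ.toLinearMap) _
    (fun _ _ => rfl)

lemma contDiff_transSnd (φ φ' : Splitting E) : ContDiff ℂ ω (transSnd φ φ') :=
  contDiff_affine (LinearMap.snd ℂ _ _ ∘ₗ φ'.symm.toLinearMap ∘ₗ φ.toLinearMap) _
    (fun _ _ => rfl)

lemma graphPoint_eq_of_isUnit (φ φ' : Splitting E) (A : GrModel E)
    (h : IsUnit (transFst φ φ' A)) :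
    graphPoint φ A = graphPoint φ' (transSnd φ φ' A * Ring.inverse (transFst φ φ' A)) := by
  refine Subtype.ext ?_
  refine Submodule.eq_of_le_of_finrank_eq ?_ ?_
  · rintro _ ⟨x, rfl⟩
    refine ⟨transFst φ φ' A x, ?_⟩
    have h1 : Ring.inverse (transFst φ φ' A) (transFst φ φ' A x) = x := by
      have := Ring.inverse_mul_cancel _ h
      exact congrArg (fun T : GrModel E => T x) this
    rw [graphMap_apply]
    change φ' (transFst φ φ' A x, transSnd φ φ' A (Ring.inverse (transFst φ φ' A) (transFst φ φ' A x)))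
      = _
    rw [h1]
    change φ' ((φ'.symm (φ (x, A x))).1, (φ'.symm (φ (x, A x))).2) = φ (x, A x)
    simp
  · rw [(graphPoint φ A).2, (graphPoint φ' _).2]

lemma isUnit_of_graphPoint_mem (φ φ' : Splitting E) (A : GrModel E)
    (h : graphPoint φ A ∈ range (graphPoint φ')) : IsUnit (transFst φ φ' A) := by
  obtain ⟨B, hB⟩ := h
  have hinj : Function.Injective (transFst φ φ' A).toLinearMap := by
    rw [← LinearMap.ker_eq_bot, LinearMap.ker_eq_bot']
    intro x hx
    have hx' : (φ'.symm (φ (x, A x))).1 = 0 := hx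
    have hmem : graphMap φ A x ∈ LinearMap.range (graphMap φ' B) := by
      have h' : LinearMap.range (graphMap φ' B) = LinearMap.range (graphMap φ A) :=
        congrArg Subtype.val hB
      rw [h']
      exact ⟨x, rfl⟩
    obtain ⟨y, hy⟩ := hmem
    rw [graphMap_apply, graphMap_apply] at hy
    rw [← hy, LinearEquiv.symm_apply_apply] at hx'
    have hy0 : y = 0 := hx'
    rw [hy0, map_zero, Prod.mk_zero_zero, map_zero] at hy
    have := (LinearEquiv.map_eq_zero_iff φ).1 hy.symm
    exact congrArg Prod.fst this
  let e : HalfSpace E ≃ₗ[ℂ] HalfSpace E := LinearEquiv.ofInjectiveEndo _ hinj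
  have he : ((e.toContinuousLinearEquiv : HalfSpace E ≃L[ℂ] HalfSpace E) : GrModel E)
      = transFst φ φ' A := by
    ext1 x
    rfl
  rw [← he]
  exact ((ContinuousLinearEquiv.unitsEquiv ℂ (HalfSpace E)).symm
    e.toContinuousLinearEquiv).isUnit

lemma trans_source (φ φ' : Splitting E) :
    ((graphChart φ).symm.trans (graphChart φ')).source = {A | IsUnit (transFst φ φ' A)} := by
  ext A
  rw [PartialEquiv.trans_source, graphChart_source]
  constructor
  · rintro ⟨-, h⟩
    exact isUnit_of_graphPoint_mem φ φ' A h
  · intro h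
    refine ⟨by simp [graphChart], ?_⟩
    exact ⟨_, (graphPoint_eq_of_isUnit φ φ' A h).symm⟩

lemma isOpen_trans_source (φ φ' : Splitting E) :
    IsOpen ((graphChart φ).symm.trans (graphChart φ')).source := by
  rw [trans_source]
  exact Units.isOpen.preimage (contDiff_transFst φ φ').continuous

lemma contDiffOn_trans (φ φ' : Splitting E) :
    ContDiffOn ℂ ω ((graphChart φ).symm.trans (graphChart φ'))
      ((graphChart φ).symm.trans (graphChart φ')).source := by
  rw [trans_source]
  have h : ContDiffOn ℂ ω
      (fun A => transSnd φ φ' A * Ring.inverse (transFst φ φ' A))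
      {A | IsUnit (transFst φ φ' A)} := by
    intro A hA
    obtain ⟨u, hu⟩ := hA
    refine ContDiffAt.contDiffWithinAt ?_
    have h1 : ContDiffAt ℂ ω (fun A => Ring.inverse (transFst φ φ' A)) A := by
      have := contDiffAt_ringInverse (n := ω) ℂ u
      rw [hu] at this
      exact this.comp A (contDiff_transFst φ φ').contDiffAt
    exact (contDiff_transSnd φ φ').contDiffAt.mul h1
  refine h.congr ?_
  intro A hA
  rw [PartialEquiv.coe_trans, Function.comp_apply, graphChart_symm_apply,
    graphPoint_eq_of_isUnit φ φ' A hA, graphChart_graphPoint]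

/-- The atlas of the Grassmannian that consists of all charts by graphs of linear maps. -/
def grCore (E : Type*) [Fintype E] : ChartedSpaceCore (GrModel E) (Gr E) where
  atlas := range graphChart
  chartAt P := graphChart (exists_splitting P).choose
  mem_chart_source P := (exists_splitting P).choose_spec
  chart_mem_atlas P := mem_range_self _
  open_source := by
    rintro _ _ ⟨φ, rfl⟩ ⟨φ', rfl⟩
    exact isOpen_trans_source φ φ'
  continuousOn_toFun := by
    rintro _ _ ⟨φ, rfl⟩ ⟨φ', rfl⟩
    exact (contDiffOn_trans φ φ').continuousOn

/-- The topology of the Grassmannian. -/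
instance instTopologicalSpaceGr (E : Type*) [Fintype E] : TopologicalSpace (Gr E) :=
  (grCore E).toTopologicalSpace

/-- The manifold structure of the Grassmannian. -/
instance instChartedSpaceGr (E : Type*) [Fintype E] : ChartedSpace (GrModel E) (Gr E) :=
  (grCore E).toChartedSpace

/-- The Grassmannian is a complex-analytic manifold. -/
instance instIsManifoldGr (E : Type*) [Fintype E] :
    IsManifold 𝓘(ℂ, GrModel E) ω (Gr E) := by
  apply isManifold_of_contDiffOn
  intro e e' he he'
  have key : ∀ f ∈ atlas (GrModel E) (Gr E), ∃ φ : Splitting E,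
      f.toPartialEquiv = graphChart φ := by
    intro f hf
    obtain ⟨g, ⟨φ, rfl⟩, rfl⟩ : ∃ g, ∃ hg : g ∈ (grCore E).atlas,
        f = (grCore E).openPartialHomeomorph g hg := by
      simpa [atlas, ChartedSpace.atlas, instChartedSpaceGr, ChartedSpaceCore.toChartedSpace]
        using hf
    exact ⟨φ, rfl⟩
  obtain ⟨φ, hφ⟩ := key e he
  obtain ⟨φ', hφ'⟩ := key e' he'
  have h : (e.symm.trans e').toPartialEquiv = (graphChart φ).symm.trans (graphChart φ') := by
    rw [OpenPartialHomeomorph.trans_toPartialEquiv, ← hφ, ← hφ']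
    rfl
  have h2 := contDiffOn_trans φ φ'
  rw [← h] at h2
  simpa using h2

end Grassmannian

/-! ## Function spaces on the graph

Every edge is parametrized by the unit interval `(0, 1)`; the edge lengths enter as scaling factors
in the operator and in the vertex values, see below. -/

/-- Lebesgue measure on the unit interval. -/
abbrev unitMeasure : Measure ℝ := volume.restrict (Ioo (0 : ℝ) 1)

/-- The space `L₂` of the unit interval. -/
abbrev L2Edge : Type := Lp ℂ 2 unitMeasure

/-- The space `L₂(Γ)`, the Hilbert sum of the spaces `L₂` of the edges. -/
abbrev L2Graph (E : Type*) : Type _ := PiLp 2 (fun _ : E => L2Edge)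

/-- The space `L_∞(Γ)` of complex potentials, with the norm `max_e ‖V_e‖_∞`. -/
abbrev Potential (E : Type*) : Type _ := E → Lp ℂ ∞ unitMeasure

/-- `v` is the weak derivative of `u` on `(0, 1)`. -/
def IsWeakDeriv (u v : L2Edge) : Prop :=
  ∀ η : ℝ → ℝ, ContDiff ℝ ∞ η → HasCompactSupport η → tsupport η ⊆ Ioo 0 1 →
    (∫ x in Ioo (0 : ℝ) 1, deriv η x • u x) = -(∫ x in Ioo (0 : ℝ) 1, η x • v x)

lemma integrable_smul {ψ : ℝ → ℝ} (hc : Continuous ψ) (hs : HasCompactSupport ψ) (u : L2Edge) :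
    Integrable (fun x => ψ x • u x) unitMeasure := by
  obtain ⟨C, hC⟩ := hs.exists_bound_of_continuous hc
  have hu : Integrable u unitMeasure := (Lp.memLp u).integrable (by norm_num)
  exact hu.bdd_smul C hc.aestronglyMeasurable (Filter.Eventually.of_forall hC)

lemma IsWeakDeriv.zero : IsWeakDeriv 0 0 := by
  intro η _ _ _
  have h : ∀ ψ : ℝ → ℝ, ∫ x in Ioo (0 : ℝ) 1, ψ x • (0 : L2Edge) x = 0 := by
    intro ψ
    rw [integral_eq_zero_of_ae]
    filter_upwards [Lp.coeFn_zero ℂ 2 unitMeasure] with x hx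
    rw [hx]
    simp
  rw [h, h, neg_zero]

lemma IsWeakDeriv.add {u v u' v' : L2Edge} (h : IsWeakDeriv u v) (h' : IsWeakDeriv u' v') :
    IsWeakDeriv (u + u') (v + v') := by
  intro η hη hs ht
  have key : ∀ ψ : ℝ → ℝ, Continuous ψ → HasCompactSupport ψ → ∀ a b : L2Edge,
      ∫ x in Ioo (0 : ℝ) 1, ψ x • (a + b) x =
        (∫ x in Ioo (0 : ℝ) 1, ψ x • a x) + ∫ x in Ioo (0 : ℝ) 1, ψ x • b x := by
    intro ψ hc hψ a b
    rw [← integral_add (integrable_smul hc hψ a) (integrable_smul hc hψ b)]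
    refine integral_congr_ae ?_
    filter_upwards [Lp.coeFn_add a b] with x hx
    rw [hx, Pi.add_apply, smul_add]
  rw [key _ (hη.continuous_deriv (by simp)) hs.deriv, key _ hη.continuous hs, h η hη hs ht,
    h' η hη hs ht, neg_add]

lemma IsWeakDeriv.smul {u v : L2Edge} (c : ℂ) (h : IsWeakDeriv u v) :
    IsWeakDeriv (c • u) (c • v) := by
  intro η hη hs ht
  have key : ∀ ψ : ℝ → ℝ, ∀ a : L2Edge,
      ∫ x in Ioo (0 : ℝ) 1, ψ x • (c • a) x = c • ∫ x in Ioo (0 : ℝ) 1, ψ x • a x := by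
    intro ψ a
    rw [← integral_smul]
    refine integral_congr_ae ?_
    filter_upwards [Lp.coeFn_smul c a] with x hx
    rw [hx, Pi.smul_apply, smul_comm]
  rw [key, key, h η hη hs ht, smul_neg]

section Operator

variable {E : Type*} [Fintype E]

/-- The Sobolev space `⨁_e H²(e)`.  An element is a family `u (e, k)`, where `u (e, 0)` is the
function on the edge `e` and `u (e, 1)`, `u (e, 2)` are its first and second weak derivatives; thus
the norm is `‖u‖² = ∑_e (‖u_e‖² + ‖u_e'‖² + ‖u_e''‖²)`. -/
def sobolevH2 (E : Type*) [Fintype E] : Submodule ℂ (PiLp 2 (fun _ : E × Fin 3 => L2Edge)) where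
  carrier := {u | ∀ e, IsWeakDeriv (u (e, 0)) (u (e, 1)) ∧ IsWeakDeriv (u (e, 1)) (u (e, 2))}
  zero_mem' _ := ⟨IsWeakDeriv.zero, IsWeakDeriv.zero⟩
  add_mem' hu hv e := ⟨(hu e).1.add (hv e).1, (hu e).2.add (hv e).2⟩
  smul_mem' c _ hu e := ⟨(hu e).1.smul c, (hu e).2.smul c⟩

/-- `f` is the representative of `u` that is continuous up to the end points. -/
def IsContinuousRep (f : ℝ → ℂ) (u : L2Edge) : Prop :=
  ContinuousOn f (Icc 0 1) ∧ f =ᵐ[unitMeasure] u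

/-- The vertex values of a function on the graph with edge lengths `ξ`, where `f e` and `g e` are
the function on the edge `e` and its derivative with respect to the parameter in `[0, 1]`:
the value and the derivative at both ends.  The derivatives are taken in the directions
into the edge and with respect to the coordinate `ξ_e t` on the edge of length `ξ_e`. -/
def endValues (ξ : E → ℂ) (f g : E → ℝ → ℂ) : VertexValues E :=
  fun e => ![f e 0, (ξ e)⁻¹ * g e 0, f e 1, -((ξ e)⁻¹ * g e 1)]

/-- The space `H(P)` of the functions in `⨁_e H²(e)` whose vertex values belong to `P`. -/
def domainH (P : Gr E) (ξ : E → ℂ) : Submodule ℂ (sobolevH2 E) where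
  carrier := {u | ∃ f g : E → ℝ → ℂ,
    (∀ e, IsContinuousRep (f e) (u.1 (e, 0)) ∧ IsContinuousRep (g e) (u.1 (e, 1))) ∧
    endValues ξ f g ∈ P.1}
  zero_mem' := by
    refine ⟨0, 0, fun e => ⟨⟨continuousOn_const, (Lp.coeFn_zero ℂ 2 unitMeasure).symm⟩,
      ⟨continuousOn_const, (Lp.coeFn_zero ℂ 2 unitMeasure).symm⟩⟩, ?_⟩
    convert P.1.zero_mem
    ext e i
    fin_cases i <;> simp [endValues]
  add_mem' := by
    rintro u v ⟨f, g, h, hP⟩ ⟨f', g', h', hP'⟩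
    refine ⟨f + f', g + g', fun e => ⟨⟨(h e).1.1.add (h' e).1.1, ?_⟩,
      ⟨(h e).2.1.add (h' e).2.1, ?_⟩⟩, ?_⟩
    · exact ((h e).1.2.add (h' e).1.2).trans (Lp.coeFn_add _ _).symm
    · exact ((h e).2.2.add (h' e).2.2).trans (Lp.coeFn_add _ _).symm
    · convert P.1.add_mem hP hP'
      ext e i
      fin_cases i <;> simp [endValues] <;> ring
  smul_mem' := by
    rintro c u ⟨f, g, h, hP⟩
    refine ⟨c • f, c • g, fun e => ⟨⟨(h e).1.1.const_smul c, ?_⟩,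
      ⟨(h e).2.1.const_smul c, ?_⟩⟩, ?_⟩
    · exact ((h e).1.2.const_smul c).trans (Lp.coeFn_smul _ _).symm
    · exact ((h e).2.2.const_smul c).trans (Lp.coeFn_smul _ _).symm
    · convert P.1.smul_mem c hP
      ext e i
      fin_cases i <;> simp [endValues] <;> ring

/-- Multiplication by a function in `L_∞`, as a bounded operator in `L₂`. -/
def mulPotential (V : Lp ℂ ∞ unitMeasure) : L2Edge →L[ℂ] L2Edge :=
  (ContinuousLinearMap.mul ℂ ℂ).holderL unitMeasure ∞ 2 2 V

/-- The bounded operator `L(P, V, ξ)` from `H(P)` to `L₂(Γ)`.  It is `-d²/dx² + V` with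
`x = ξ_e t`, that is, `-ξ_e⁻² d²/dt² + V_e` in terms of the parameter `t` of the edge `e`. -/
def schrodinger (P : Gr E) (V : Potential E) (ξ : E → ℂ) : domainH P ξ →L[ℂ] L2Graph E :=
  (PiLp.continuousLinearEquiv 2 ℂ (fun _ : E => L2Edge)).symm.toContinuousLinearMap ∘L
    ContinuousLinearMap.pi (fun e =>
      -((ξ e)⁻¹ ^ 2) • PiLp.proj 2 (𝕜 := ℂ) (fun _ : E × Fin 3 => L2Edge) (e, 2) +
        mulPotential (V e) ∘L PiLp.proj 2 (𝕜 := ℂ) (fun _ : E × Fin 3 => L2Edge) (e, 0)) ∘L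
    (sobolevH2 E).subtypeL ∘L (domainH P ξ).subtypeL

/-- The embedding of `H(P)` into `L₂(Γ)`, that is, the identity operator `I` in `L - λ I`. -/
def embedding (P : Gr E) (ξ : E → ℂ) : domainH P ξ →L[ℂ] L2Graph E :=
  (PiLp.continuousLinearEquiv 2 ℂ (fun _ : E => L2Edge)).symm.toContinuousLinearMap ∘L
    ContinuousLinearMap.pi (fun e =>
      PiLp.proj 2 (𝕜 := ℂ) (fun _ : E × Fin 3 => L2Edge) (e, 0)) ∘L
    (sobolevH2 E).subtypeL ∘L (domainH P ξ).subtypeL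

lemma schrodinger_apply (P : Gr E) (V : Potential E) (ξ : E → ℂ) (u : domainH P ξ) (e : E) :
    schrodinger P V ξ u e = -((ξ e)⁻¹ ^ 2) • u.1.1 (e, 2) + mulPotential (V e) (u.1.1 (e, 0)) :=
  rfl

lemma embedding_apply (P : Gr E) (ξ : E → ℂ) (u : domainH P ξ) (e : E) :
    embedding P ξ u e = u.1.1 (e, 0) := rfl

lemma mulPotential_apply (V : Lp ℂ ∞ unitMeasure) (u : L2Edge) :
    mulPotential V u =ᵐ[unitMeasure] fun x => V x * u x :=
  ContinuousLinearMap.coeFn_holder (ContinuousLinearMap.mul ℂ ℂ) V u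

end Operator

/-! ## The parameter space and the dispersion relation -/

/-- The set `(ℂ ∖ {0})^|E|` of edge lengths, an open submanifold of `ℂ^|E|`. -/
def EdgeLengths (E : Type*) [Fintype E] : TopologicalSpace.Opens (E → ℂ) where
  carrier := {ξ | ∀ e, ξ e ≠ 0}
  is_open' := by
    simp only [ofPred_forall]
    exact isOpen_iInter_of_finite fun e => isOpen_ne_fun (continuous_apply e) continuous_const

/-- The manifold `G(2|E|, 4|E|) × L_∞(Γ) × (ℂ ∖ {0})^|E| × ℂ`. -/
abbrev Parameters (E : Type*) [Fintype E] : Type _ := Gr E × Potential E × EdgeLengths E × ℂ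

/-- The model of the manifold of parameters. -/
abbrev parametersModel (E : Type*) [Fintype E] :=
  𝓘(ℂ, GrModel E).prod (𝓘(ℂ, Potential E).prod (𝓘(ℂ, E → ℂ).prod 𝓘(ℂ, ℂ)))

/-- The extended dispersion relation: the set of all `(P, V, ξ, lam)` for which the operator
`L(P, V, ξ) - lam I` from `H(P)` to `L₂(Γ)` has no bounded inverse. -/
def dispersionRelation (E : Type*) [Fintype E] : Set (Parameters E) :=
  {p | ¬ (schrodinger p.1 p.2.1 p.2.2.1 - p.2.2.2 • embedding p.1 p.2.2.1).IsInvertible}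

end QuantumGraph

end

open MeasureTheory Set Module
open scoped ENNReal Manifold ContDiff Topology

noncomputable section

namespace QuantumGraph

/-! ## The Volterra operator -/

/-! On an edge, a function in `H²` is the same thing as its initial values `c = (u(0), u'(0))`
together with `h = u''`: with the Volterra operator `J f = ∫₀ᵗ f`, it is `u = c₀ + c₁ t + J² h`.
This rests on the lemma of du Bois-Reymond through `isWeakDeriv_iff`, and it replaces the varying
domain `H(P)` by linear conditions on a fixed Banach space.

In these coordinates `-ξ⁻² u'' + V u - λ u = g` becomes `h - q J² h = q (c₀ + c₁ t) - ξ² g` with `q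
= ξ² (V - λ)`. The operator `1 - q J²` is invertible for every `q`, because norms of powers of a
Volterra operator decay factorially (`isUnit_one_sub_volterraMul`). So `h` is determined by `c` and
`g`, and only the vertex condition remains.

If `P` is the graph of `A : P₀ → R`, the vertex condition says that the `R`-component of the vertex
values minus `A` of the `P₀`-component is zero: `2|E|` linear equations for the `2|E|` unknowns `c`.
With `charMap` the matrix of this system, the operator is invertible exactly when `det charMap ≠ 0`
(`isInvertible_iff_det_charMap_ne_zero`).

Finally, `q` is polynomial in the parameters, inversion is analytic on the units of a Banach
algebra, and the vertex values involve only `ξ_e⁻¹` besides. So the determinant is analytic in `(A,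
V, ξ, λ)` and is the required local equation (`contDiffOn_det_charMap`). -/

instance : IsProbabilityMeasure unitMeasure := ⟨by simp⟩

lemma integrable_L2Edge (f : L2Edge) : Integrable f unitMeasure :=
  (Lp.memLp f).integrable (by norm_num)

lemma integral_norm_le_norm (f : L2Edge) : ∫ s, ‖f s‖ ∂unitMeasure ≤ ‖f‖ := by
  have h1 : eLpNorm f 1 unitMeasure ≤ eLpNorm f 2 unitMeasure :=
    eLpNorm_le_eLpNorm_of_exponent_le (by norm_num) (Lp.aestronglyMeasurable f)
  rw [integral_norm_eq_lintegral_enorm (Lp.aestronglyMeasurable f), ← eLpNorm_one_eq_lintegral_enorm,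
    Lp.norm_def]
  exact ENNReal.toReal_mono (Lp.eLpNorm_ne_top f) h1

/-- The interval has mass one, so a uniform bound passes to the `L₂` norm with no extra constant. -/
lemma norm_le_of_ae_norm_le {f : L2Edge} {C : ℝ} (hC : 0 ≤ C)
    (h : ∀ᵐ t ∂unitMeasure, ‖f t‖ ≤ C) : ‖f‖ ≤ C := by
  have := Lp.norm_le_of_ae_bound hC h
  simpa [measureUnivNNReal] using this

/-- The primitive of `f` that vanishes at `0`. -/
def prim (f : L2Edge) (t : ℝ) : ℂ := ∫ s in (0 : ℝ)..t, f s ∂unitMeasure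

lemma prim_zero_right (f : L2Edge) : prim f 0 = 0 := by simp [prim]

lemma continuous_prim (f : L2Edge) : Continuous (prim f) :=
  (integrable_L2Edge f).continuous_primitive 0

lemma prim_add (f g : L2Edge) (t : ℝ) : prim (f + g) t = prim f t + prim g t := by
  rw [prim, prim, prim, ← intervalIntegral.integral_add (integrable_L2Edge f).intervalIntegrable
    (integrable_L2Edge g).intervalIntegrable]
  refine intervalIntegral.integral_congr_ae ?_
  filter_upwards [Lp.coeFn_add f g] with x hx _
  rw [hx, Pi.add_apply]

lemma prim_smul (c : ℂ) (f : L2Edge) (t : ℝ) : prim (c • f) t = c * prim f t := by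
  rw [prim, prim, ← smul_eq_mul, ← intervalIntegral.integral_smul]
  refine intervalIntegral.integral_congr_ae ?_
  filter_upwards [Lp.coeFn_smul c f] with x hx _
  rw [hx, Pi.smul_apply]

lemma norm_prim_le (f : L2Edge) (t : ℝ) : ‖prim f t‖ ≤ ‖f‖ :=
  (intervalIntegral.norm_integral_le_integral_norm_uIoc).trans <|
    (setIntegral_le_integral (integrable_L2Edge f).norm
      (Filter.Eventually.of_forall fun _ => norm_nonneg _)).trans (integral_norm_le_norm f)

lemma memLp_prim (f : L2Edge) : MemLp (prim f) 2 unitMeasure :=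
  MemLp.of_bound (continuous_prim f).aestronglyMeasurable ‖f‖
    (Filter.Eventually.of_forall (norm_prim_le f))

/-- The Volterra operator `f ↦ ∫₀ᵗ f`. -/
def volterra : L2Edge →L[ℂ] L2Edge :=
  LinearMap.mkContinuous
    { toFun := fun f => (memLp_prim f).toLp _
      map_add' := fun f g => by
        rw [← MemLp.toLp_add]
        congr 1
        exact funext (prim_add f g)
      map_smul' := fun c f => by
        rw [RingHom.id_apply, ← MemLp.toLp_const_smul]
        congr 1
        exact funext (prim_smul c f) } 1 (fun f => by
    rw [one_mul]
    refine norm_le_of_ae_norm_le (norm_nonneg _) ?_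
    filter_upwards [(memLp_prim f).coeFn_toLp] with t ht
    change ‖((memLp_prim f).toLp _ : L2Edge) t‖ ≤ _
    rw [ht]
    exact norm_prim_le f t)

lemma coeFn_volterra (f : L2Edge) : volterra f =ᵐ[unitMeasure] prim f :=
  (memLp_prim f).coeFn_toLp

lemma prim_eq_integral (f : L2Edge) {t : ℝ} (ht : t ∈ Icc (0 : ℝ) 1) :
    prim f t = ∫ s in (0 : ℝ)..t, f s := by
  rw [prim, intervalIntegral.integral_of_le ht.1, intervalIntegral.integral_of_le ht.1,
    Measure.restrict_restrict measurableSet_Ioc, integral_Ioc_eq_integral_Ioo]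
  have h : (Ioc 0 t ∩ Ioo 0 1 : Set ℝ) =ᵐ[volume] Ioo 0 t := by
    have h1 : (Ioo 0 t : Set ℝ) = Ioo 0 t ∩ Ioo 0 1 := by
      ext x; simp only [mem_inter_iff, mem_Ioo]
      exact ⟨fun h => ⟨h, h.1, h.2.trans_le ht.2⟩, fun h => h.1⟩
    rw [h1]
    exact Ioo_ae_eq_Ioc.symm.inter (ae_eq_refl _)
  exact setIntegral_congr_set h

/-- Each integration raises the power of `t` and the factorial by one; this is the source of the
factorial decay. -/
lemma norm_prim_le_pow {f : L2Edge} {C : ℝ} {n : ℕ}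
    (h : ∀ᵐ s ∂unitMeasure, ‖f s‖ ≤ C * (s ^ n / n.factorial)) {t : ℝ} (ht : t ∈ Icc (0 : ℝ) 1) :
    ‖prim f t‖ ≤ C * (t ^ (n + 1) / (n + 1).factorial) := by
  have hi : ∫ s in (0 : ℝ)..t, C * (s ^ n / n.factorial) =
      C * (t ^ (n + 1) / (n + 1).factorial) := by
    rw [intervalIntegral.integral_const_mul, intervalIntegral.integral_div, integral_pow,
      Nat.factorial_succ]
    push_cast
    field_simp
    simp
  rw [prim_eq_integral f ht, ← hi]
  refine intervalIntegral.norm_integral_le_of_norm_le ht.1 ?_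
    (Continuous.intervalIntegrable (by fun_prop) _ _)
  rw [ae_restrict_iff' measurableSet_Ioo] at h
  -- The hypothesis concerns the open interval, while the integral runs over `(0, t]`, which
  -- contains `1` when `t = 1`.
  have h1 : ∀ᵐ s : ℝ, s ≠ 1 := by simp [ae_iff]
  filter_upwards [h, h1] with s hs hs1 hst
  exact hs ⟨hst.1, lt_of_le_of_ne (hst.2.trans ht.2) hs1⟩

/-! ## Multiplication by a potential -/

lemma ae_norm_le_norm (q : Lp ℂ ∞ unitMeasure) : ∀ᵐ t ∂unitMeasure, ‖q t‖ ≤ ‖q‖ := by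
  have h := ae_le_eLpNormEssSup (f := q) (μ := unitMeasure)
  filter_upwards [h] with t ht
  rw [Lp.norm_def, eLpNorm_exponent_top]
  have := ENNReal.toReal_mono (by
    rw [← eLpNorm_exponent_top]; exact Lp.eLpNorm_ne_top q) ht
  simpa using this

/-- The operator `f ↦ q ∫₀ᵗ ∫₀ˢ f`. -/
def volterraMul (q : Lp ℂ ∞ unitMeasure) : L2Edge →L[ℂ] L2Edge :=
  mulPotential q ∘L volterra ∘L volterra

/-- The induction runs on the primitive of the iterate, since an `L₂` function has no pointwise
bound to start from whereas its primitive is bounded by its norm. -/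
lemma norm_prim_volterraMul_pow_le (q : Lp ℂ ∞ unitMeasure) (f : L2Edge) (n : ℕ) :
    ∀ t ∈ Icc (0 : ℝ) 1,
      ‖prim ((volterraMul q ^ n) f) t‖ ≤ ‖q‖ ^ n * ‖f‖ * (t ^ n / n.factorial) := by
  induction n with
  | zero => intro t _; simpa using norm_prim_le f t
  | succ n ih =>
    intro t ht
    set g := (volterraMul q ^ n) f
    have h1 : ∀ᵐ s ∂unitMeasure,
        ‖volterra g s‖ ≤ ‖q‖ ^ n * ‖f‖ * (s ^ n / n.factorial) := by
      filter_upwards [coeFn_volterra g, ae_restrict_mem measurableSet_Ioo] with s hs hs'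
      rw [hs]
      exact ih s (Ioo_subset_Icc_self hs')
    have h2 : ∀ᵐ s ∂unitMeasure,
        ‖volterraMul q g s‖ ≤ (‖q‖ ^ (n + 1) * ‖f‖) * (s ^ n / n.factorial) := by
      filter_upwards [coeFn_volterra (volterra g), mulPotential_apply q (volterra (volterra g)),
        ae_norm_le_norm q, ae_restrict_mem measurableSet_Ioo] with s hs hm hq hs'
      have h3 := norm_prim_le_pow h1 (Ioo_subset_Icc_self hs')
      change ‖mulPotential q (volterra (volterra g)) s‖ ≤ _
      rw [hm, hs, norm_mul]
      -- An iteration integrates twice, but the gain from one integration suffices; the other is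
      -- discarded here.
      have h4 : s ^ (n + 1) / (n + 1).factorial ≤ s ^ n / n.factorial := by
        have hf : (n.factorial : ℝ) ≤ (n + 1).factorial := by
          exact_mod_cast Nat.factorial_le (Nat.le_succ n)
        exact div_le_div₀ (pow_nonneg hs'.1.le _)
          (pow_le_pow_of_le_one hs'.1.le hs'.2.le (Nat.le_succ n))
          (by exact_mod_cast n.factorial_pos) hf
      calc ‖q s‖ * ‖prim (volterra g) s‖
          ≤ ‖q‖ * (‖q‖ ^ n * ‖f‖ * (s ^ n / n.factorial)) := by gcongr; exact h3.trans (by gcongr)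
        _ = _ := by ring
    rw [pow_succ']
    exact norm_prim_le_pow h2 ht

/-- Some power of `T = q J²` has norm less than one, so `1 - T ^ (n + 1)` is a unit. It is the
product of `1 - T` and a geometric sum; the factors commute, so both are units. No smallness of `q`
is needed. -/
lemma isUnit_one_sub_volterraMul (q : Lp ℂ ∞ unitMeasure) : IsUnit (1 - volterraMul q) := by
  set T := volterraMul q
  have hT : ∀ n, ‖T ^ (n + 1)‖ ≤ ‖mulPotential q ∘L volterra‖ * (‖q‖ ^ n / n.factorial) := by
    intro n
    have h1 : ‖volterra ∘L (T ^ n)‖ ≤ ‖q‖ ^ n / n.factorial := by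
      refine ContinuousLinearMap.opNorm_le_bound _ (by positivity) fun f => ?_
      refine norm_le_of_ae_norm_le (by positivity) ?_
      filter_upwards [coeFn_volterra ((T ^ n) f), ae_restrict_mem measurableSet_Ioo] with s hs hs'
      change ‖volterra ((T ^ n) f) s‖ ≤ _
      rw [hs]
      refine (norm_prim_volterraMul_pow_le q f n s (Ioo_subset_Icc_self hs')).trans ?_
      have : s ^ n ≤ 1 := pow_le_one₀ hs'.1.le hs'.2.le
      calc ‖q‖ ^ n * ‖f‖ * (s ^ n / n.factorial) ≤ ‖q‖ ^ n * ‖f‖ * (1 / n.factorial) := by gcongr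
        _ = _ := by ring
    -- Splitting off `q J` leaves `J Tⁿ`, to which the pointwise bound on primitives applies.
    have h2 : T ^ (n + 1) = (mulPotential q ∘L volterra) ∘L (volterra ∘L (T ^ n)) := by
      rw [pow_succ']; rfl
    rw [h2]
    exact (ContinuousLinearMap.opNorm_comp_le _ _).trans (by gcongr)
  have hlim := (FloorSemiring.tendsto_pow_div_factorial_atTop ‖q‖).const_mul
    ‖mulPotential q ∘L volterra‖
  rw [mul_zero] at hlim
  obtain ⟨n, hn⟩ := (hlim.eventually (gt_mem_nhds one_pos)).exists
  have hu : IsUnit (1 - T ^ (n + 1)) := isUnit_one_sub_of_norm_lt_one ((hT n).trans_lt hn)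
  have hc : Commute (1 - T) (∑ i ∈ Finset.range (n + 1), T ^ i) :=
    (Commute.one_left _).sub_left (Commute.sum_right _ _ _ fun i _ => Commute.self_pow T i)
  rw [← mul_neg_geom_sum, hc.isUnit_mul_iff] at hu
  exact hu.1

/-! ## Weak derivatives and primitives -/

/-- The constant function `1`. -/
def oneL2 : L2Edge := (memLp_const (1 : ℂ)).toLp _

lemma coeFn_oneL2 : oneL2 =ᵐ[unitMeasure] fun _ => 1 := (memLp_const (1 : ℂ)).coeFn_toLp

lemma coeFn_smul_oneL2 (a : ℂ) : (a • oneL2 : L2Edge) =ᵐ[unitMeasure] fun _ => a := by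
  filter_upwards [Lp.coeFn_smul a oneL2, coeFn_oneL2] with x h1 h2
  rw [h1, Pi.smul_apply, h2, smul_eq_mul, mul_one]

lemma coeFn_smul_oneL2_add_volterra (a : ℂ) (v : L2Edge) :
    (a • oneL2 + volterra v : L2Edge) =ᵐ[unitMeasure] fun t => a + prim v t := by
  filter_upwards [Lp.coeFn_add (a • oneL2) (volterra v), coeFn_smul_oneL2 a, coeFn_volterra v]
    with x h1 h2 h3
  rw [h1, Pi.add_apply, h2, h3]

lemma eq_zero_of_notMem_Ioo {η : ℝ → ℝ} (ht : tsupport η ⊆ Ioo 0 1) {x : ℝ}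
    (hx : x ∉ Ioo (0 : ℝ) 1) : η x = 0 :=
  image_eq_zero_of_notMem_tsupport fun h => hx (ht h)

/-- The fundamental theorem of calculus, with `η(1) = 0` by the support condition. It is the inner
integral in the Fubini argument for primitives, and `s = 0` gives the case of constants. -/
lemma setIntegral_Ici_deriv {η : ℝ → ℝ} (hη : ContDiff ℝ ∞ η) (ht : tsupport η ⊆ Ioo 0 1)
    {s : ℝ} (hs : s ∈ Ico (0 : ℝ) 1) : ∫ t in Ici s, deriv η t ∂unitMeasure = -η s := by
  have h : (Ici s ∩ Ioo 0 1 : Set ℝ) =ᵐ[volume] Ioc s 1 := by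
    have h1 : (Ioo s 1 : Set ℝ) = Ioi s ∩ Ioo 0 1 := by
      ext x; simp only [mem_inter_iff, mem_Ioo, mem_Ioi]
      exact ⟨fun h => ⟨h.1, hs.1.trans_lt h.1, h.2⟩, fun h => ⟨h.1, h.2.2⟩⟩
    refine Filter.EventuallyEq.trans ?_ Ioo_ae_eq_Ioc
    rw [h1]
    exact Ioi_ae_eq_Ici.symm.inter (ae_eq_refl _)
  rw [Measure.restrict_restrict measurableSet_Ici, setIntegral_congr_set h,
    ← intervalIntegral.integral_of_le hs.2.le,
    intervalIntegral.integral_deriv_eq_sub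
      (fun x _ => (hη.differentiable (by simp)).differentiableAt)
      ((hη.continuous_deriv (by simp)).intervalIntegrable _ _),
    eq_zero_of_notMem_Ioo ht (by simp), zero_sub]

lemma isWeakDeriv_smul_oneL2 (a : ℂ) : IsWeakDeriv (a • oneL2) 0 := by
  intro η hη hs ht
  have h0 : ∫ x in Ioo (0 : ℝ) 1, η x • (0 : L2Edge) x = 0 := by
    rw [integral_eq_zero_of_ae]
    filter_upwards [Lp.coeFn_zero ℂ 2 unitMeasure] with x hx
    rw [hx]
    simp
  have h1 : ∫ x in Ioo (0 : ℝ) 1, deriv η x • (a • oneL2 : L2Edge) x =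
      ∫ x in Ioo (0 : ℝ) 1, deriv η x • a := by
    refine integral_congr_ae ?_
    filter_upwards [coeFn_smul_oneL2 a] with x hx
    rw [hx]
  have h2 : ∫ x in Ioo (0 : ℝ) 1, deriv η x = 0 := by
    have h3 := setIntegral_Ici_deriv hη ht (s := 0) (by simp)
    rw [Measure.restrict_restrict measurableSet_Ici,
      inter_eq_self_of_subset_right fun x hx => hx.1.le,
      eq_zero_of_notMem_Ioo ht (by simp), neg_zero] at h3
    exact h3
  rw [h0, neg_zero, h1, integral_smul_const, h2, zero_smul]

lemma prim_eq_setIntegral_Iic (v : L2Edge) {t : ℝ} (ht : 0 ≤ t) :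
    prim v t = ∫ s in Iic t, v s ∂unitMeasure := by
  rw [prim, intervalIntegral.integral_of_le ht, Measure.restrict_restrict measurableSet_Ioc,
    Measure.restrict_restrict measurableSet_Iic]
  congr 2
  ext x
  simp only [mem_inter_iff, mem_Ioc, mem_Iic, mem_Ioo]
  tauto

/-- Fubini on the triangle `s ≤ t`: integrating `η'(t) v(s)` first over `s` gives the pairing of
`η'` with the primitive, and first over `t` gives `-η(s) v(s)`. -/
lemma isWeakDeriv_volterra (v : L2Edge) : IsWeakDeriv (volterra v) v := by
  intro η hη hs ht
  have hc : Continuous (deriv η) := hη.continuous_deriv (by simp)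
  have hi : Integrable (deriv η) unitMeasure :=
    (hc.integrable_of_hasCompactSupport hs.deriv).restrict
  let F : ℝ → ℝ → ℂ := fun t s => (Iic t).indicator (fun s => deriv η t • v s) s
  have hF : Integrable (Function.uncurry F) (unitMeasure.prod unitMeasure) := by
    have h1 : Integrable (fun z : ℝ × ℝ => deriv η z.1 • v z.2) (unitMeasure.prod unitMeasure) :=
      hi.smul_prod (integrable_L2Edge v)
    have h2 : Function.uncurry F =
        {z : ℝ × ℝ | z.2 ≤ z.1}.indicator (fun z => deriv η z.1 • v z.2) := by
      funext z
      by_cases h : z.2 ≤ z.1 <;> simp [F, Function.uncurry, indicator, h]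
    rw [h2]
    exact h1.indicator (measurableSet_le measurable_snd measurable_fst)
  calc ∫ t in Ioo (0 : ℝ) 1, deriv η t • volterra v t
      = ∫ t, ∫ s, F t s ∂unitMeasure ∂unitMeasure := by
        refine integral_congr_ae ?_
        filter_upwards [coeFn_volterra v, ae_restrict_mem measurableSet_Ioo] with t h1 h2
        rw [h1, prim_eq_setIntegral_Iic v h2.1.le, integral_indicator measurableSet_Iic,
          integral_smul]
    _ = ∫ s, ∫ t, F t s ∂unitMeasure ∂unitMeasure := integral_integral_swap hF
    _ = ∫ s in Ioo (0 : ℝ) 1, -(η s • v s) := by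
        refine integral_congr_ae ?_
        filter_upwards [ae_restrict_mem measurableSet_Ioo] with s h2
        have h3 : (fun t => F t s) = (Ici s).indicator (fun t => deriv η t • v s) := by
          funext t
          by_cases h : s ≤ t <;> simp [F, indicator, h]
        rw [h3, integral_indicator measurableSet_Ici, integral_smul_const,
          setIntegral_Ici_deriv hη ht ⟨h2.1.le, h2.2⟩, neg_smul]
    _ = _ := integral_neg _

/-- A test function with zero mean is the derivative of a test function. -/
lemma exists_deriv_eq_of_integral_eq_zero {θ : ℝ → ℝ} (hθ : ContDiff ℝ ∞ θ)
    (hs : HasCompactSupport θ) (ht : tsupport θ ⊆ Ioo 0 1)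
    (h0 : ∫ x in Ioo (0 : ℝ) 1, θ x = 0) :
    ∃ ψ : ℝ → ℝ, ContDiff ℝ ∞ ψ ∧ HasCompactSupport ψ ∧ tsupport ψ ⊆ Ioo 0 1 ∧ deriv ψ = θ := by
  let ψ : ℝ → ℝ := fun t => ∫ s in (0 : ℝ)..t, θ s
  have hd : ∀ t, HasDerivAt ψ (θ t) t := fun t =>
    (hθ.continuous.integral_hasStrictDerivAt 0 t).hasDerivAt
  have hd' : deriv ψ = θ := funext fun t => (hd t).deriv
  obtain ⟨a, b, ha, hb, hab⟩ : ∃ a b : ℝ, 0 < a ∧ b < 1 ∧ tsupport θ ⊆ Icc a b := by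
    -- The point `1/2` is added so that the compact set is nonempty even for `θ = 0`; its infimum
    -- and supremum then lie in `(0, 1)`.
    have hK : IsCompact (insert (1 / 2 : ℝ) (tsupport θ)) := hs.isCompact.insert _
    have hsub : insert (1 / 2 : ℝ) (tsupport θ) ⊆ Ioo 0 1 :=
      insert_subset ⟨by norm_num, by norm_num⟩ ht
    have hne : (insert (1 / 2 : ℝ) (tsupport θ)).Nonempty := insert_nonempty _ _
    exact ⟨_, _, (hsub (hK.sInf_mem hne)).1, (hsub (hK.sSup_mem hne)).2, fun x hx =>
      ⟨csInf_le hK.bddBelow (mem_insert_of_mem _ hx), le_csSup hK.bddAbove (mem_insert_of_mem _ hx)⟩⟩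
  have hz : ∀ x, x ∉ Icc a b → θ x = 0 := fun x hx =>
    image_eq_zero_of_notMem_tsupport fun h => hx (hab h)
  have h01 : ∫ s in (0 : ℝ)..1, θ s = 0 := by
    rw [intervalIntegral.integral_of_le zero_le_one, integral_Ioc_eq_integral_Ioo, h0]
  have hsupp : Function.support ψ ⊆ Icc a b := by
    intro t htt
    by_contra hn
    apply htt
    rcases lt_or_ge t a with h | h
    · change ∫ s in (0 : ℝ)..t, θ s = 0
      rw [intervalIntegral.integral_congr (g := fun _ => 0), intervalIntegral.integral_zero]
      intro x hx
      refine hz x fun hx' => ?_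
      have := hx.2
      exact absurd (hx'.1.trans this) (not_le.2 (max_lt ha h))
    · have hbt : b < t := by
        by_contra h'
        exact hn ⟨h, not_lt.1 h'⟩
      change ∫ s in (0 : ℝ)..t, θ s = 0
      rw [← intervalIntegral.integral_add_adjacent_intervals (b := 1)
        (hθ.continuous.intervalIntegrable _ _) (hθ.continuous.intervalIntegrable _ _), h01, zero_add,
        intervalIntegral.integral_congr (g := fun _ => 0), intervalIntegral.integral_zero]
      intro x hx
      refine hz x fun hx' => ?_
      have := hx.1
      exact absurd (this.trans hx'.2) (not_le.2 (lt_min hb hbt))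
  have htsupp : tsupport ψ ⊆ Icc a b := closure_minimal hsupp isClosed_Icc
  refine ⟨ψ, ?_, HasCompactSupport.of_support_subset_isCompact isCompact_Icc hsupp,
    fun x hx => ⟨ha.trans_le (htsupp hx).1, (htsupp hx).2.trans_lt hb⟩, hd'⟩
  rw [contDiff_infty_iff_deriv, hd']
  exact ⟨fun t => (hd t).differentiableAt, hθ⟩

/-- The lemma of du Bois-Reymond. -/
lemma IsWeakDeriv.eq_smul_oneL2 {w : L2Edge} (hw : IsWeakDeriv w 0) : ∃ a : ℂ, w = a • oneL2 := by
  let ρ : ContDiffBump (1 / 2 : ℝ) := ⟨1 / 8, 1 / 4, by norm_num, by norm_num⟩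
  let η : ℝ → ℝ := ρ.normed volume
  have hη : ContDiff ℝ ∞ η := ρ.contDiff_normed
  have hηs : HasCompactSupport η := ρ.hasCompactSupport_normed
  have hηt : tsupport η ⊆ Ioo 0 1 := by
    rw [show tsupport η = _ from ρ.tsupport_normed_eq, Real.closedBall_eq_Icc]
    intro x hx
    have h1 : (1 / 2 - 1 / 4 : ℝ) ≤ x := hx.1
    have h2 : x ≤ (1 / 2 + 1 / 4 : ℝ) := hx.2
    exact ⟨by linarith, by linarith⟩
  have hint : ∀ φ : ℝ → ℝ, tsupport φ ⊆ Ioo 0 1 → ∫ x in Ioo (0 : ℝ) 1, φ x = ∫ x, φ x :=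
    fun φ h => setIntegral_eq_integral_of_forall_compl_eq_zero fun x hx =>
      eq_zero_of_notMem_Ioo h hx
  have hη1 : ∫ x in Ioo (0 : ℝ) 1, η x = 1 := by
    rw [hint η hηt]
    exact ρ.integral_normed
  -- If `w` is constant, its value must be its average against the bump `η` of integral one.
  set a : ℂ := ∫ x in Ioo (0 : ℝ) 1, η x • w x with ha
  refine ⟨a, ?_⟩
  have hwi : Integrable w unitMeasure := integrable_L2Edge w
  have hloc : LocallyIntegrableOn (fun x => w x - a) (Ioo 0 1) volume := by
    have : IntegrableOn (fun x => w x - a) (Ioo 0 1) volume := hwi.sub (integrable_const a)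
    exact this.locallyIntegrableOn
  have key := isOpen_Ioo.ae_eq_zero_of_integral_contDiff_smul_eq_zero hloc (by
    intro φ hφ hφs hφt
    set m : ℝ := ∫ x in Ioo (0 : ℝ) 1, φ x with hm
    -- Subtracting `m η` makes the mean zero, so `θ` is the derivative of a test function and pairs
    -- to zero with `w`; this says `∫ φ w = m a = ∫ φ a`.
    let θ : ℝ → ℝ := fun x => φ x - m * η x
    have hφi : Integrable φ unitMeasure :=
      (hφ.continuous.integrable_of_hasCompactSupport hφs).restrict
    have hηi : Integrable η unitMeasure :=
      (hη.continuous.integrable_of_hasCompactSupport hηs).restrict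
    have hθ0 : ∫ x in Ioo (0 : ℝ) 1, θ x = 0 := by
      rw [integral_sub hφi (hηi.const_mul m), integral_const_mul, hη1, mul_one, sub_self]
    have hsub : Function.support θ ⊆ tsupport φ ∪ tsupport η := by
      intro x hx
      by_contra hn
      rw [mem_union, not_or] at hn
      apply hx
      simp [θ, image_eq_zero_of_notMem_tsupport hn.1, image_eq_zero_of_notMem_tsupport hn.2]
    have hcomp : IsCompact (tsupport φ ∪ tsupport η) := hφs.isCompact.union hηs.isCompact
    obtain ⟨ψ, hψ, hψs, hψt, hd⟩ := exists_deriv_eq_of_integral_eq_zero (θ := θ)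
      (hφ.sub (contDiff_const.mul hη)) (HasCompactSupport.of_support_subset_isCompact hcomp hsub)
      ((closure_minimal hsub hcomp.isClosed).trans (union_subset hφt hηt)) hθ0
    have h1 := hw ψ hψ hψs hψt
    have h0 : ∫ x in Ioo (0 : ℝ) 1, ψ x • (0 : L2Edge) x = 0 := by
      rw [integral_eq_zero_of_ae]
      filter_upwards [Lp.coeFn_zero ℂ 2 unitMeasure] with x hx
      rw [hx]
      simp
    rw [h0, neg_zero, hd] at h1
    have h2 : ∫ x in Ioo (0 : ℝ) 1, θ x • w x = (∫ x in Ioo (0 : ℝ) 1, φ x • w x) - m • a := by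
      have hi : Integrable (fun x => m • η x • w x) unitMeasure :=
        (integrable_smul hη.continuous hηs w).smul m
      rw [ha, ← integral_smul, ← integral_sub (integrable_smul hφ.continuous hφs w) hi]
      refine integral_congr_ae (Filter.Eventually.of_forall fun x => ?_)
      simp only [θ, sub_smul, mul_smul]
    have h3 : ∫ x, φ x • (w x - a) = ∫ x in Ioo (0 : ℝ) 1, φ x • (w x - a) := by
      refine (setIntegral_eq_integral_of_forall_compl_eq_zero fun x hx => ?_).symm
      rw [eq_zero_of_notMem_Ioo hφt hx, zero_smul]
    rw [h3]
    simp only [smul_sub]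
    rw [integral_sub (integrable_smul hφ.continuous hφs w) (hφi.smul_const a),
      integral_smul_const, ← hm, ← h2, h1])
  refine Lp.ext ?_
  have key' : ∀ᵐ x ∂unitMeasure, w x - a = 0 := (ae_restrict_iff' measurableSet_Ioo).2 key
  filter_upwards [key', coeFn_smul_oneL2 a] with x h1 h2
  rw [h2, sub_eq_zero.1 h1]

/-- Since `v` is also the weak derivative of its primitive, `u` minus that primitive has weak
derivative zero and is constant. -/
lemma isWeakDeriv_iff {u v : L2Edge} :
    IsWeakDeriv u v ↔ ∃ a : ℂ, u = a • oneL2 + volterra v := by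
  constructor
  · intro h
    have h1 := h.add ((isWeakDeriv_volterra v).smul (-1))
    rw [neg_smul, neg_smul, one_smul, one_smul, add_neg_cancel] at h1
    obtain ⟨a, ha⟩ := h1.eq_smul_oneL2
    exact ⟨a, by rw [← ha]; abel⟩
  · rintro ⟨a, rfl⟩
    simpa using (isWeakDeriv_smul_oneL2 a).add (isWeakDeriv_volterra v)

/-- Makes the vertex values independent of the representatives chosen in `domainH`, end points
included. -/
lemma IsContinuousRep.eqOn {f g : ℝ → ℂ} {u : L2Edge} (hf : IsContinuousRep f u)
    (hg : IsContinuousRep g u) : EqOn f g (Icc 0 1) := by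
  refine Measure.eqOn_Icc_of_ae_eq volume zero_ne_one ?_ hf.1 hg.1
  rw [← restrict_Ioo_eq_restrict_Icc]
  exact hf.2.trans hg.2.symm

lemma isContinuousRep_add_prim (a : ℂ) (v : L2Edge) :
    IsContinuousRep (fun t => a + prim v t) (a • oneL2 + volterra v) :=
  ⟨(continuous_const.add (continuous_prim v)).continuousOn,
    (coeFn_smul_oneL2_add_volterra a v).symm⟩

/-! ## The equation on one edge -/

lemma oneL2_ne_zero : oneL2 ≠ 0 := by
  intro h
  have h1 : ∀ᵐ x ∂unitMeasure, False := by
    filter_upwards [coeFn_oneL2, Lp.coeFn_zero ℂ 2 unitMeasure] with x h1 h2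
    rw [h, h2] at h1
    exact zero_ne_one h1
  rw [Filter.eventually_false_iff_eq_bot, ae_eq_bot] at h1
  exact IsProbabilityMeasure.ne_zero unitMeasure h1

/-- The functional `f ↦ ∫₀¹ f`. -/
def total : L2Edge →L[ℂ] ℂ :=
  LinearMap.mkContinuous
    { toFun := fun f => prim f 1
      map_add' := fun f g => prim_add f g 1
      map_smul' := fun c f => prim_smul c f 1 } 1 (fun f => by
    rw [one_mul]
    exact norm_prim_le f 1)

lemma total_apply (f : L2Edge) : total f = prim f 1 := rfl

/-- The constant potential `1`. -/
def oneLinf : Lp ℂ ∞ unitMeasure := (memLp_const (1 : ℂ)).toLp _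

lemma mulPotential_oneLinf (u : L2Edge) : mulPotential oneLinf u = u := by
  refine Lp.ext ?_
  have h : oneLinf =ᵐ[unitMeasure] fun _ => (1 : ℂ) := (memLp_const (1 : ℂ)).coeFn_toLp
  filter_upwards [mulPotential_apply oneLinf u, h] with x h1 h2
  rw [h1, h2, one_mul]

/-- `mulPotential` as a bounded linear map. -/
def mulPotentialL : Lp ℂ ∞ unitMeasure →L[ℂ] L2Edge →L[ℂ] L2Edge :=
  (ContinuousLinearMap.mul ℂ ℂ).holderL unitMeasure ∞ 2 2

lemma mulPotentialL_apply (q : Lp ℂ ∞ unitMeasure) : mulPotentialL q = mulPotential q := rfl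

/-- The potential `q` such that `-ξ⁻² u'' + V u = λ u` is equivalent to `u'' = q u`. -/
def edgeCoeff (V : Lp ℂ ∞ unitMeasure) (ξ lam : ℂ) : Lp ℂ ∞ unitMeasure :=
  ξ ^ 2 • (V - lam • oneLinf)

lemma mulPotential_edgeCoeff (V : Lp ℂ ∞ unitMeasure) (ξ lam : ℂ) (u : L2Edge) :
    mulPotential (edgeCoeff V ξ lam) u = ξ ^ 2 • (mulPotential V u - lam • u) := by
  have h := mulPotential_oneLinf u
  rw [← mulPotentialL_apply] at h ⊢
  rw [edgeCoeff, map_smul, map_sub, map_smul, _root_.smul_apply,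
    _root_.sub_apply, _root_.smul_apply, h, mulPotentialL_apply]

/-- The inverse of the operator `h ↦ h - q ∫₀ᵗ ∫₀ˢ h`. -/
def resolvent (q : Lp ℂ ∞ unitMeasure) : L2Edge →L[ℂ] L2Edge :=
  Ring.inverse (1 - volterraMul q)

lemma sub_volterraMul_eq_iff (q : Lp ℂ ∞ unitMeasure) (h k : L2Edge) :
    h - volterraMul q h = k ↔ h = resolvent q k := by
  have hu := isUnit_one_sub_volterraMul q
  constructor
  · rintro rfl
    exact (congrArg (fun T : L2Edge →L[ℂ] L2Edge => T h) (Ring.inverse_mul_cancel _ hu)).symm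
  · rintro rfl
    exact congrArg (fun T : L2Edge →L[ℂ] L2Edge => T k) (Ring.mul_inverse_cancel _ hu)

/-- The second derivative of the solution of `u'' = q u` with initial values `c`. -/
def shootEdge (q : Lp ℂ ∞ unitMeasure) (c : Fin 2 → ℂ) : L2Edge :=
  resolvent q (mulPotential q (c 0 • oneL2 + c 1 • volterra oneL2))

/-- Multiplication by `-ξ²`, which is reversible because `ξ ≠ 0`, turns the differential equation
into the Volterra equation for `h`, and the resolvent solves it. -/
lemma edge_equation_iff (V : Lp ℂ ∞ unitMeasure) {ξ : ℂ} (hξ : ξ ≠ 0) (lam : ℂ) (c : Fin 2 → ℂ)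
    (h g : L2Edge) :
    -(ξ⁻¹ ^ 2) • h + mulPotential V (c 0 • oneL2 + volterra (c 1 • oneL2 + volterra h)) -
        lam • (c 0 • oneL2 + volterra (c 1 • oneL2 + volterra h)) = g ↔
      h = shootEdge (edgeCoeff V ξ lam) c - ξ ^ 2 • resolvent (edgeCoeff V ξ lam) g := by
  set q := edgeCoeff V ξ lam with hq
  obtain ⟨u, hu⟩ : ∃ u, u = c 0 • oneL2 + volterra (c 1 • oneL2 + volterra h) := ⟨_, rfl⟩
  rw [← hu]
  have hu' : u = (c 0 • oneL2 + c 1 • volterra oneL2) + volterra (volterra h) := by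
    rw [hu, map_add, map_smul, add_assoc]
  rw [shootEdge, ← (resolvent q).map_smul, ← (resolvent q).map_sub, ← sub_volterraMul_eq_iff]
  have h1 : h - volterraMul q h -
      (mulPotential q (c 0 • oneL2 + c 1 • volterra oneL2) - ξ ^ 2 • g) =
      -(ξ ^ 2) • (-(ξ⁻¹ ^ 2) • h + mulPotential V u - lam • u - g) := by
    have h2 : volterraMul q h + mulPotential q (c 0 • oneL2 + c 1 • volterra oneL2) =
        mulPotential q u := by
      rw [hu', map_add _ (_ + _), add_comm]; rfl
    have h3 : h - volterraMul q h -
      (mulPotential q (c 0 • oneL2 + c 1 • volterra oneL2) - ξ ^ 2 • g) =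
        h - (volterraMul q h + mulPotential q (c 0 • oneL2 + c 1 • volterra oneL2)) + ξ ^ 2 • g := by
      abel
    have h4 : ξ ^ 2 * ξ⁻¹ ^ 2 = 1 := by field_simp
    rw [h3, h2, hq, mulPotential_edgeCoeff]
    have h5 : -(ξ ^ 2) • (-(ξ⁻¹ ^ 2) • h + mulPotential V u - lam • u - g) =
        (ξ ^ 2 * ξ⁻¹ ^ 2) • h - ξ ^ 2 • (mulPotential V u - lam • u) + ξ ^ 2 • g := by module
    rw [h5, h4, one_smul]
  rw [← sub_eq_zero, ← sub_eq_zero (a := h - volterraMul q h), h1, smul_eq_zero]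
  simp [hξ]

/-! ## The equation on the graph -/

section Graph

variable {E : Type*}

/-- The map that sends `(c, h)` to the derivative of the function `u` with `u'' = h` and initial
values `c` on the edge `e`. -/
def edgeDeriv (e : E) : (HalfSpace E × (E → L2Edge)) →L[ℂ] L2Edge :=
  (ContinuousLinearMap.proj (R := ℂ) (φ := fun _ : Fin 2 => ℂ) 1 ∘L
      ContinuousLinearMap.proj (R := ℂ) (φ := fun _ : E => Fin 2 → ℂ) e ∘L
      ContinuousLinearMap.fst ℂ (HalfSpace E) (E → L2Edge)).smulRight oneL2 +
    volterra ∘L ContinuousLinearMap.proj (R := ℂ) (φ := fun _ : E => L2Edge) e ∘L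
      ContinuousLinearMap.snd ℂ (HalfSpace E) (E → L2Edge)

lemma edgeDeriv_apply (e : E) (x : HalfSpace E × (E → L2Edge)) :
    edgeDeriv e x = x.1 e 1 • oneL2 + volterra (x.2 e) := rfl

/-- The map that sends `(c, h)` to the function `u` with `u'' = h` and initial values `c` on the
edge `e`. -/
def edgeFun (e : E) : (HalfSpace E × (E → L2Edge)) →L[ℂ] L2Edge :=
  (ContinuousLinearMap.proj (R := ℂ) (φ := fun _ : Fin 2 => ℂ) 0 ∘L
      ContinuousLinearMap.proj (R := ℂ) (φ := fun _ : E => Fin 2 → ℂ) e ∘L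
      ContinuousLinearMap.fst ℂ (HalfSpace E) (E → L2Edge)).smulRight oneL2 +
    volterra ∘L edgeDeriv e

lemma edgeFun_apply (e : E) (x : HalfSpace E × (E → L2Edge)) :
    edgeFun e x = x.1 e 0 • oneL2 + volterra (x.1 e 1 • oneL2 + volterra (x.2 e)) := rfl

/-- The vertex values in terms of the initial values and the second derivative. -/
def vertexMap (ξ : E → ℂ) : (HalfSpace E × (E → L2Edge)) →L[ℂ] VertexValues E :=
  ContinuousLinearMap.pi fun e => ContinuousLinearMap.pi
    ![ContinuousLinearMap.proj (R := ℂ) (φ := fun _ : Fin 2 => ℂ) 0 ∘L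
        ContinuousLinearMap.proj (R := ℂ) (φ := fun _ : E => Fin 2 → ℂ) e ∘L
        ContinuousLinearMap.fst ℂ (HalfSpace E) (E → L2Edge),
      (ξ e)⁻¹ • (ContinuousLinearMap.proj (R := ℂ) (φ := fun _ : Fin 2 => ℂ) 1 ∘L
        ContinuousLinearMap.proj (R := ℂ) (φ := fun _ : E => Fin 2 → ℂ) e ∘L
        ContinuousLinearMap.fst ℂ (HalfSpace E) (E → L2Edge)),
      ContinuousLinearMap.proj (R := ℂ) (φ := fun _ : Fin 2 => ℂ) 0 ∘L
        ContinuousLinearMap.proj (R := ℂ) (φ := fun _ : E => Fin 2 → ℂ) e ∘L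
        ContinuousLinearMap.fst ℂ (HalfSpace E) (E → L2Edge) + total ∘L edgeDeriv e,
      -((ξ e)⁻¹ • (ContinuousLinearMap.proj (R := ℂ) (φ := fun _ : Fin 2 => ℂ) 1 ∘L
        ContinuousLinearMap.proj (R := ℂ) (φ := fun _ : E => Fin 2 → ℂ) e ∘L
        ContinuousLinearMap.fst ℂ (HalfSpace E) (E → L2Edge) +
          total ∘L ContinuousLinearMap.proj (R := ℂ) (φ := fun _ : E => L2Edge) e ∘L
            ContinuousLinearMap.snd ℂ (HalfSpace E) (E → L2Edge)))]

lemma vertexMap_apply (ξ : E → ℂ) (x : HalfSpace E × (E → L2Edge)) (e : E) :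
    vertexMap ξ x e = ![x.1 e 0, (ξ e)⁻¹ * x.1 e 1, x.1 e 0 + total (edgeDeriv e x),
      -((ξ e)⁻¹ * (x.1 e 1 + total (x.2 e)))] := by
  ext i
  fin_cases i <;> rfl

/-- The second derivatives of the solutions of `u'' = q u` with given initial values. -/
def shoot (q : E → Lp ℂ ∞ unitMeasure) : HalfSpace E →ₗ[ℂ] (E → L2Edge) where
  toFun c e := shootEdge (q e) (c e)
  map_add' c d := by
    ext1 e
    simp only [shootEdge, Pi.add_apply]
    rw [← map_add, ← map_add]
    congr 2
    module
  map_smul' r c := by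
    ext1 e
    simp only [shootEdge, Pi.smul_apply, RingHom.id_apply]
    rw [← (resolvent _).map_smul, ← (mulPotential _).map_smul]
    congr 2
    rw [smul_add, smul_smul, smul_smul]
    rfl

lemma shoot_apply (q : E → Lp ℂ ∞ unitMeasure) (c : HalfSpace E) (e : E) :
    shoot q c e = shootEdge (q e) (c e) := rfl

/-- The coefficients of the equation on all edges. -/
def graphCoeff (V : Potential E) (ξ : E → ℂ) (lam : ℂ) : E → Lp ℂ ∞ unitMeasure :=
  fun e => edgeCoeff (V e) (ξ e) lam

/-- The solution of the inhomogeneous equation with zero initial values. -/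
def particular (V : Potential E) (ξ : E → ℂ) (lam : ℂ) : L2Graph E →L[ℂ] (E → L2Edge) :=
  ContinuousLinearMap.pi fun e =>
    -((ξ e ^ 2) • (resolvent (edgeCoeff (V e) (ξ e) lam) ∘L
      PiLp.proj 2 (𝕜 := ℂ) (fun _ : E => L2Edge) e))

lemma particular_apply (V : Potential E) (ξ : E → ℂ) (lam : ℂ) (g : L2Graph E) (e : E) :
    particular V ξ lam g e = -(ξ e ^ 2 • resolvent (edgeCoeff (V e) (ξ e) lam) (g e)) := rfl

variable [Fintype E]

/-- The parametrization of the Sobolev space by the initial values and the second derivative. -/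
def sobolevMk : (HalfSpace E × (E → L2Edge)) →L[ℂ] sobolevH2 E :=
  ((PiLp.continuousLinearEquiv 2 ℂ (fun _ : E × Fin 3 => L2Edge)).symm.toContinuousLinearMap ∘L
    ContinuousLinearMap.pi (fun p : E × Fin 3 =>
      ![edgeFun p.1, edgeDeriv p.1,
        ContinuousLinearMap.proj (R := ℂ) (φ := fun _ : E => L2Edge) p.1 ∘L
          ContinuousLinearMap.snd ℂ (HalfSpace E) (E → L2Edge)] p.2)).codRestrict (sobolevH2 E)
    (fun x e => ⟨isWeakDeriv_iff.2 ⟨x.1 e 0, rfl⟩, isWeakDeriv_iff.2 ⟨x.1 e 1, rfl⟩⟩)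

lemma sobolevMk_zero (x : HalfSpace E × (E → L2Edge)) (e : E) :
    (sobolevMk x).1 (e, 0) = edgeFun e x := rfl

lemma sobolevMk_one (x : HalfSpace E × (E → L2Edge)) (e : E) :
    (sobolevMk x).1 (e, 1) = edgeDeriv e x := rfl

lemma sobolevMk_injective : Function.Injective (sobolevMk (E := E)) := by
  rw [injective_iff_map_eq_zero]
  rintro ⟨c, h⟩ hx
  have hk : ∀ p, (sobolevMk (c, h)).1 p = 0 := fun p => by rw [hx]; rfl
  have h2 : ∀ e, h e = 0 := fun e => hk (e, 2)
  have h1 : ∀ e, c e 1 = 0 := fun e => by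
    have := hk (e, 1)
    rw [sobolevMk_one, edgeDeriv_apply] at this
    simpa [h2, oneL2_ne_zero] using this
  have h0 : ∀ e, c e 0 = 0 := fun e => by
    have := hk (e, 0)
    rw [sobolevMk_zero, edgeFun_apply] at this
    simpa [h2, h1, oneL2_ne_zero] using this
  refine Prod.ext ?_ (funext h2)
  ext e i
  fin_cases i
  · exact h0 e
  · exact h1 e

/-- The two constants of integration, from `u'` to `u` and from `u''` to `u'`, serve as the initial
values. -/
lemma sobolevMk_surjective : Function.Surjective (sobolevMk (E := E)) := by
  intro u
  choose a ha using fun e => isWeakDeriv_iff.1 (u.2 e).1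
  choose b hb using fun e => isWeakDeriv_iff.1 (u.2 e).2
  refine ⟨(fun e => ![a e, b e], fun e => u.1 (e, 2)), Subtype.ext ?_⟩
  ext1 ⟨e, k⟩
  fin_cases k
  · change edgeFun e _ = u.1 (e, 0)
    rw [edgeFun_apply, ha e, hb e]
    rfl
  · change edgeDeriv e _ = u.1 (e, 1)
    rw [edgeDeriv_apply, hb e]
    rfl
  · rfl

/-- The primitives give explicit continuous representatives whose end values are `vertexMap`; by
uniqueness any other representatives give the same values. -/
lemma sobolevMk_mem_domainH (P : Gr E) (ξ : E → ℂ) (x : HalfSpace E × (E → L2Edge)) :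
    sobolevMk x ∈ domainH P ξ ↔ vertexMap ξ x ∈ P.1 := by
  let f : E → ℝ → ℂ := fun e t => x.1 e 0 + prim (edgeDeriv e x) t
  let g : E → ℝ → ℂ := fun e t => x.1 e 1 + prim (x.2 e) t
  have hf : ∀ e, IsContinuousRep (f e) ((sobolevMk x).1 (e, 0)) := fun e =>
    isContinuousRep_add_prim (x.1 e 0) (edgeDeriv e x)
  have hg : ∀ e, IsContinuousRep (g e) ((sobolevMk x).1 (e, 1)) := fun e =>
    isContinuousRep_add_prim (x.1 e 1) (x.2 e)
  have hv : endValues ξ f g = vertexMap ξ x := by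
    funext e
    rw [vertexMap_apply, endValues]
    simp only [f, g, prim_zero_right, add_zero, total_apply]
  rw [← hv]
  constructor
  · rintro ⟨f', g', hfg, hP⟩
    have h0 : (0 : ℝ) ∈ Icc (0 : ℝ) 1 := by simp
    have h1 : (1 : ℝ) ∈ Icc (0 : ℝ) 1 := by simp
    have : endValues ξ f' g' = endValues ξ f g := by
      funext e
      simp only [endValues]
      rw [(hfg e).1.eqOn (hf e) h0, (hfg e).1.eqOn (hf e) h1, (hfg e).2.eqOn (hg e) h0,
        (hfg e).2.eqOn (hg e) h1]
    rwa [← this]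
  · exact fun h => ⟨f, g, fun e => ⟨hf e, hg e⟩, h⟩

/-- The projection of `ℂ^(4|E|)` onto `R` along the graph of `A : P₀ → R`. -/
def graphDefect (φ : Splitting E) (A : GrModel E) : VertexValues E →ₗ[ℂ] HalfSpace E :=
  LinearMap.snd ℂ _ _ ∘ₗ φ.symm.toLinearMap -
    A.toLinearMap ∘ₗ LinearMap.fst ℂ _ _ ∘ₗ φ.symm.toLinearMap

lemma graphDefect_apply (φ : Splitting E) (A : GrModel E) (w : VertexValues E) :
    graphDefect φ A w = (φ.symm w).2 - A (φ.symm w).1 := rfl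

lemma graphDefect_eq_zero_iff (φ : Splitting E) (A : GrModel E) (w : VertexValues E) :
    graphDefect φ A w = 0 ↔ w ∈ (graphPoint φ A).1 := by
  rw [graphDefect_apply, sub_eq_zero]
  constructor
  · intro h
    refine ⟨(φ.symm w).1, ?_⟩
    rw [graphMap_apply, ← h]
    exact φ.apply_symm_apply w
  · rintro ⟨x, rfl⟩
    rw [graphMap_apply, φ.symm_apply_apply]

/-- The map that sends initial values to the defect of the vertex values of the solution of the
homogeneous equation. -/
def charMap (φ : Splitting E) (A : GrModel E) (V : Potential E) (ξ : E → ℂ) (lam : ℂ) :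
    HalfSpace E →ₗ[ℂ] HalfSpace E :=
  graphDefect φ A ∘ₗ (vertexMap ξ).toLinearMap ∘ₗ
    LinearMap.prod LinearMap.id (shoot (graphCoeff V ξ lam))

lemma charMap_apply (φ : Splitting E) (A : GrModel E) (V : Potential E) (ξ : E → ℂ) (lam : ℂ)
    (c : HalfSpace E) : charMap φ A V ξ lam c =
      graphDefect φ A (vertexMap ξ (c, shoot (graphCoeff V ξ lam) c)) := rfl

/-- The equation is local on edges: the vertex condition enters only through the membership `hx`,
and `x.1` is left free. -/
lemma schrodinger_sub_eq_iff (P : Gr E) (V : Potential E) {ξ : E → ℂ} (hξ : ∀ e, ξ e ≠ 0)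
    (lam : ℂ) (x : HalfSpace E × (E → L2Edge)) (hx : sobolevMk x ∈ domainH P ξ) (g : L2Graph E) :
    (schrodinger P V ξ - lam • embedding P ξ) ⟨sobolevMk x, hx⟩ = g ↔
      x.2 = shoot (graphCoeff V ξ lam) x.1 + particular V ξ lam g := by
  rw [PiLp.ext_iff, funext_iff]
  refine forall_congr' fun e => ?_
  rw [Pi.add_apply, shoot_apply, particular_apply, ← sub_eq_add_neg]
  exact edge_equation_iff (V e) (hξ e) lam (x.1 e) (x.2 e) (g e)

/-- A nonzero kernel vector `c` of `charMap` gives the solution of the homogeneous equation with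
initial values `c`. It lies in `H(P)` and is nonzero, which contradicts injectivity. -/
lemma det_charMap_ne_zero (φ : Splitting E) (A : GrModel E) (V : Potential E) {ξ : E → ℂ}
    (hξ : ∀ e, ξ e ≠ 0) (lam : ℂ)
    (hinj : Function.Injective
      (schrodinger (graphPoint φ A) V ξ - lam • embedding (graphPoint φ A) ξ)) :
    LinearMap.det (charMap φ A V ξ lam) ≠ 0 := by
  intro h
  have hker := LinearMap.bot_lt_ker_of_det_eq_zero h
  obtain ⟨c, hc, hc0⟩ := Submodule.exists_mem_ne_zero_of_ne_bot hker.ne'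
  rw [LinearMap.mem_ker, charMap_apply, graphDefect_eq_zero_iff, ← sobolevMk_mem_domainH] at hc
  have h1 := (schrodinger_sub_eq_iff _ V hξ lam _ hc 0).2 (by simp)
  have h2 := hinj (h1.trans (map_zero _).symm)
  have h3 : sobolevMk (c, shoot (graphCoeff V ξ lam) c) = 0 := congrArg Subtype.val h2
  have h4 := sobolevMk_injective (h3.trans (map_zero _).symm)
  exact hc0 (congrArg Prod.fst h4)

lemma isInvertible_of_det_charMap_ne_zero (φ : Splitting E) (A : GrModel E) (V : Potential E)
    {ξ : E → ℂ} (hξ : ∀ e, ξ e ≠ 0) (lam : ℂ) (hdet : LinearMap.det (charMap φ A V ξ lam) ≠ 0) :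
    (schrodinger (graphPoint φ A) V ξ - lam • embedding (graphPoint φ A) ξ).IsInvertible := by
  set T := schrodinger (graphPoint φ A) V ξ - lam • embedding (graphPoint φ A) ξ with hT
  let C : HalfSpace E ≃ₗ[ℂ] HalfSpace E :=
    LinearEquiv.ofIsUnitDet (v := Module.finBasis ℂ (HalfSpace E)) (v' := Module.finBasis ℂ (HalfSpace E))
      (f := charMap φ A V ξ lam) (by rw [LinearMap.det_toMatrix]; exact hdet.isUnit)
  have hC : ∀ c, C c = charMap φ A V ξ lam c := fun c => rfl
  -- The initial values are chosen so that the homogeneous solution cancels the vertex defect of the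
  -- particular solution. Every map here is continuous, so the inverse is bounded by construction.
  let c : L2Graph E →L[ℂ] HalfSpace E :=
    -(LinearMap.toContinuousLinearMap (C.symm.toLinearMap ∘ₗ graphDefect φ A) ∘L vertexMap ξ ∘L
      ContinuousLinearMap.inr ℂ (HalfSpace E) (E → L2Edge) ∘L particular V ξ lam)
  let h : L2Graph E →L[ℂ] (E → L2Edge) :=
    LinearMap.toContinuousLinearMap (shoot (graphCoeff V ξ lam)) ∘L c + particular V ξ lam
  have hmem : ∀ g, sobolevMk (c g, h g) ∈ domainH (graphPoint φ A) ξ := by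
    intro g
    rw [sobolevMk_mem_domainH, ← graphDefect_eq_zero_iff]
    have h1 : (c g, h g) = (c g, shoot (graphCoeff V ξ lam) (c g)) + (0, particular V ξ lam g) := by
      rw [Prod.mk_add_mk, add_zero]; rfl
    have h2 : c g = -C.symm (graphDefect φ A (vertexMap ξ (0, particular V ξ lam g))) := rfl
    rw [h1, map_add, map_add, ← charMap_apply, ← hC, h2, map_neg, C.apply_symm_apply, neg_add_cancel]
  let S : L2Graph E →L[ℂ] domainH (graphPoint φ A) ξ :=
    (sobolevMk ∘L c.prod h).codRestrict _ hmem
  have hright : ∀ g, T (S g) = g := fun g =>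
    (schrodinger_sub_eq_iff _ V hξ lam (c g, h g) (hmem g) g).2 rfl
  have hinj : Function.Injective T := by
    rw [injective_iff_map_eq_zero]
    rintro ⟨u, hu⟩ h0
    obtain ⟨⟨d, k⟩, rfl⟩ := sobolevMk_surjective u
    have h1 := (schrodinger_sub_eq_iff _ V hξ lam (d, k) hu 0).1 h0
    have h2 : k = shoot (graphCoeff V ξ lam) d := by simpa using h1
    rw [sobolevMk_mem_domainH, ← graphDefect_eq_zero_iff, h2, ← charMap_apply, ← hC,
      LinearEquiv.map_eq_zero_iff] at hu
    refine Subtype.ext ?_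
    change sobolevMk (d, k) = 0
    rw [h2, hu, map_zero, Prod.mk_zero_zero, map_zero]
  -- A right inverse of an injective map is also a left inverse: `T (S (T u)) = T u` forces `S (T u)
  -- = u`.
  exact ⟨ContinuousLinearEquiv.equivOfInverse T S (fun u => hinj (hright (T u))) hright, rfl⟩

lemma isInvertible_iff_det_charMap_ne_zero (φ : Splitting E) (A : GrModel E) (V : Potential E)
    {ξ : E → ℂ} (hξ : ∀ e, ξ e ≠ 0) (lam : ℂ) :
    (schrodinger (graphPoint φ A) V ξ - lam • embedding (graphPoint φ A) ξ).IsInvertible ↔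
      LinearMap.det (charMap φ A V ξ lam) ≠ 0 :=
  ⟨fun h => det_charMap_ne_zero φ A V hξ lam h.bijective.injective,
    isInvertible_of_det_charMap_ne_zero φ A V hξ lam⟩

end Graph

/-! ## Analyticity -/

/-- The determinant of an analytic family of endomorphisms is analytic. -/
lemma contDiffOn_det {X W : Type*} [NormedAddCommGroup X] [NormedSpace ℂ X]
    [NormedAddCommGroup W] [NormedSpace ℂ W] [FiniteDimensional ℂ W] {s : Set X}
    {G : X → W →ₗ[ℂ] W} (hG : ∀ c, ContDiffOn ℂ ω (fun p => G p c) s) :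
    ContDiffOn ℂ ω (fun p => LinearMap.det (G p)) s := by
  let b := Module.finBasis ℂ W
  have h : (fun p => LinearMap.det (G p)) = fun p => (LinearMap.toMatrix b b (G p)).det := by
    funext p
    rw [LinearMap.det_toMatrix]
  rw [h]
  simp only [Matrix.det_apply]
  refine ContDiffOn.sum fun σ _ => ContDiffOn.const_smul _ (contDiffOn_prod fun i _ => ?_)
  -- A matrix entry evaluates `G p` at a fixed basis vector, so analyticity at each fixed vector is
  -- enough.
  simp only [LinearMap.toMatrix_apply]
  exact (LinearMap.toContinuousLinearMap (b.coord (σ i))).contDiff.comp_contDiffOn (hG (b i))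

section

variable {E : Type*} [Fintype E]

/-- `1 - volterraMul q` is affine and continuous in `q` and always a unit, and inversion is analytic
at units; hence analyticity on the whole space of potentials. -/
lemma contDiff_resolvent : ContDiff ℂ ω resolvent := by
  rw [contDiff_iff_contDiffAt]
  intro q
  have h : ContDiff ℂ ω fun q : Lp ℂ ∞ unitMeasure => 1 - volterraMul q := by
    have : ContDiff ℂ ω fun q : Lp ℂ ∞ unitMeasure =>
        (1 : L2Edge →L[ℂ] L2Edge) - (mulPotentialL q) ∘L (volterra ∘L volterra) := by
      fun_prop
    exact this
  obtain ⟨u, hu⟩ := isUnit_one_sub_volterraMul q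
  have h1 := contDiffAt_ringInverse (n := ω) ℂ u
  rw [hu] at h1
  exact h1.comp q h.contDiffAt

lemma contDiff_shootEdge (c : Fin 2 → ℂ) : ContDiff ℂ ω fun q => shootEdge q c := by
  have h : ContDiff ℂ ω fun q : Lp ℂ ∞ unitMeasure =>
      mulPotentialL q (c 0 • oneL2 + c 1 • volterra oneL2) := by fun_prop
  exact contDiff_resolvent.clm_apply h

/-- Edge lengths that do not vanish, as a condition on the coordinates of a parameter. -/
def lengthsNeZero (E : Type*) [Fintype E] : Set (GrModel E × Potential E × (E → ℂ) × ℂ) :=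
  {p | ∀ e, p.2.2.1 e ≠ 0}

lemma contDiff_graphCoeff : ContDiff ℂ ω
    fun p : GrModel E × Potential E × (E → ℂ) × ℂ => graphCoeff p.2.1 p.2.2.1 p.2.2.2 := by
  refine contDiff_pi.2 fun e => ?_
  unfold graphCoeff edgeCoeff
  fun_prop

/-- The initial values `c` are fixed, so `shoot` depends analytically on all parameters; only the
factors `ξ_e⁻¹` in the derivative entries require nonzero lengths. -/
lemma contDiffOn_vertexMap_shoot (c : HalfSpace E) : ContDiffOn ℂ ω
    (fun p : GrModel E × Potential E × (E → ℂ) × ℂ =>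
      vertexMap p.2.2.1 (c, shoot (graphCoeff p.2.1 p.2.2.1 p.2.2.2) c)) (lengthsNeZero E) := by
  refine contDiffOn_pi.2 fun e => ?_
  have hs : ContDiff ℂ ω fun p : GrModel E × Potential E × (E → ℂ) × ℂ =>
      shootEdge (graphCoeff p.2.1 p.2.2.1 p.2.2.2 e) (c e) :=
    (contDiff_shootEdge (c e)).comp (contDiff_pi.1 contDiff_graphCoeff e)
  have hξ : ContDiffOn ℂ ω (fun p : GrModel E × Potential E × (E → ℂ) × ℂ => (p.2.2.1 e)⁻¹)
      (lengthsNeZero E) := by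
    refine ContDiffOn.inv ?_ fun p hp => hp e
    fun_prop
  simp only [vertexMap_apply, edgeDeriv_apply, shoot_apply]
  have h2 : ContDiff ℂ ω fun p : GrModel E × Potential E × (E → ℂ) × ℂ =>
      c e 0 + total (c e 1 • oneL2 +
        volterra (shootEdge (graphCoeff p.2.1 p.2.2.1 p.2.2.2 e) (c e))) := by fun_prop
  have h3 : ContDiff ℂ ω fun p : GrModel E × Potential E × (E → ℂ) × ℂ =>
      c e 1 + total (shootEdge (graphCoeff p.2.1 p.2.2.1 p.2.2.2 e) (c e)) := by fun_prop
  refine contDiffOn_pi.2 fun i => ?_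
  fin_cases i
  · exact contDiffOn_const
  · exact hξ.mul contDiffOn_const
  · exact h2.contDiffOn
  · exact (hξ.mul h3.contDiffOn).neg

lemma contDiffOn_det_charMap (φ : Splitting E) : ContDiffOn ℂ ω
    (fun p : GrModel E × Potential E × (E → ℂ) × ℂ =>
      LinearMap.det (charMap φ p.1 p.2.1 p.2.2.1 p.2.2.2)) (lengthsNeZero E) := by
  refine contDiffOn_det fun c => ?_
  have hw := contDiffOn_vertexMap_shoot c
  have hfst : ContDiff ℂ ω (fun w : VertexValues E => (φ.symm w).1) :=
    (LinearMap.toContinuousLinearMap (LinearMap.fst ℂ _ _ ∘ₗ φ.symm.toLinearMap)).contDiff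
  have hsnd : ContDiff ℂ ω (fun w : VertexValues E => (φ.symm w).2) :=
    (LinearMap.toContinuousLinearMap (LinearMap.snd ℂ _ _ ∘ₗ φ.symm.toLinearMap)).contDiff
  simp only [charMap_apply, graphDefect_apply]
  exact (hsnd.comp_contDiffOn hw).sub
    (contDiff_fst.contDiffOn.clm_apply (hfst.comp_contDiffOn hw))

end

end QuantumGraph

/-! ### The local equation of the dispersion relation -/

open QuantumGraph in
theorem mainTheorem2 (E : Type*) [Fintype E] :
    QuantumGraph.IsPrincipalAnalyticSubset (QuantumGraph.parametersModel E)
      (QuantumGraph.dispersionRelation E) := by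
  intro p
  set χ := chartAt (GrModel E) p.1 with hχ
  -- The preferred chart at `p.1` is, by construction of the atlas, the graph chart of a chosen
  -- splitting.
  obtain ⟨φ, hφ⟩ : ∃ φ : Splitting E, χ.toPartialEquiv = graphChart φ := ⟨_, rfl⟩
  let κ : Parameters E → GrModel E × Potential E × (E → ℂ) × ℂ :=
    fun x => (χ x.1, x.2.1, x.2.2.1, x.2.2.2)
  -- Only the subspace `P` has to be localized: the same determinant works for all potentials,
  -- lengths and spectral parameters.
  refine ⟨Prod.fst ⁻¹' χ.source, χ.open_source.preimage continuous_fst, mem_chart_source (GrModel E) p.1,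
    fun x => LinearMap.det (charMap φ (κ x).1 (κ x).2.1 (κ x).2.2.1 (κ x).2.2.2), ?_, ?_⟩
  · have h1 : ContMDiffOn (parametersModel E) 𝓘(ℂ, GrModel E) ω (fun x : Parameters E => χ x.1)
        (Prod.fst ⁻¹' χ.source) :=
      (contMDiffOn_chart (I := 𝓘(ℂ, GrModel E)) (n := ω) (x := p.1)).comp
        contMDiff_fst.contMDiffOn (fun _ hx => hx)
    have h2 : ContMDiff (parametersModel E) 𝓘(ℂ, Potential E) ω (fun x : Parameters E => x.2.1) :=
      contMDiff_fst.comp contMDiff_snd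
    have h3 : ContMDiff (parametersModel E) 𝓘(ℂ, E → ℂ) ω
        (fun x : Parameters E => (x.2.2.1 : E → ℂ)) :=
      contMDiff_subtype_val.comp (contMDiff_fst.comp (contMDiff_snd.comp contMDiff_snd))
    have h4 : ContMDiff (parametersModel E) 𝓘(ℂ, ℂ) ω (fun x : Parameters E => x.2.2.2) :=
      contMDiff_snd.comp (contMDiff_snd.comp contMDiff_snd)
    have hκ : ContMDiffOn (parametersModel E) 𝓘(ℂ, GrModel E × Potential E × (E → ℂ) × ℂ) ω κ
        (Prod.fst ⁻¹' χ.source) :=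
      h1.prodMk_space (h2.prodMk_space (h3.prodMk_space h4)).contMDiffOn
    exact (contDiffOn_det_charMap φ).contMDiffOn.comp hκ fun x _ => x.2.2.1.2
  · intro x hx
    have hP : graphPoint φ (χ x.1) = x.1 := by
      have := χ.left_inv hx
      change χ.toPartialEquiv.symm (χ.toPartialEquiv x.1) = x.1 at this
      change graphPoint φ (χ.toPartialEquiv x.1) = x.1
      rw [hφ] at this ⊢
      exact this
    have h := isInvertible_iff_det_charMap_ne_zero φ (χ x.1) x.2.1 x.2.2.1.2 x.2.2.2
    rw [hP] at h
    exact (not_congr h).trans not_not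

end
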